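/- Let $G$ be a finite group. A conjugacy class $C$ of $G$ is called real if $C^{-1}=C$, where $C^{-1}=\{g^{-1}: g\in C\}$, and complex otherwise. Let $C_1,\dots,C_{r_1}$ be the real conjugacy classes of $G$, let $r_2$ be half the number of complex conjugacy classes, and put $$d=d(G)=(-1)^{r_2}\,|G|^{r_1}\prod_{j=1}^{r_1}|C_j|^{-1}.$$ For an integer $a$ define $\left(\frac{a}{G}\right)$ to be $0$ if $\gcd(a,|G|)\neq 1$, and otherwise the sign ($\pm1$) of the permutation of the set of conjugacy classes of $G$ induced by $g\mapsto g^a$. Let $\left(\frac{d}{a}\right)$ be the Kronecker symbol: for $a\ne 0$ it is multiplicative in $a$, it is the Legendre symbol when $a$ is an odd prime, $\left(\frac{d}{2}\right)$ is $0$ if $d$ is even, $1$ if $d\equiv\pm1\pmod 8$ and $-1$ if $d\equiv\pm3\pmod 8$, $\left(\frac{d}{-1}\right)$ is the sign of $d$, and $\left(\frac{d}{0}\right)$ is $1$ if $d=\pm1$ and $0$ otherwise. Then $d$ is a non-zero integer with $d\equiv 0$ or $1\pmod 4$, and for every integer $a$ $$\left(\frac{a}{G}\right)=\left(\frac{d}{a}\right).$$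 In particular, $\left(\frac{\cdot}{G}\right)$ is trivial (that is, $\left(\frac{a}{G}\right)=1$ for every integer $a$ with $\gcd(a,|G|)=1$) if and only if $d$ is the square of an integer. -/

import Mathlib

namespace GroupReciprocity

/-- The Kronecker symbol `(d/p)` at a prime `p`: the Legendre symbol for odd `p`, and the usual
value depending on `d` modulo `8` for `p = 2`. (For `d ≡ 0, 1` modulo `4` the residue `7` does
not occur.) -/
def kroneckerPrime (d : ℤ) (p : ℕ) : ℤ :=
  if p = 2 then
    if d % 2 = 0 then 0 else if d % 8 = 1 ∨ d % 8 = 7 then 1 else -1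
  else jacobiSym d p

/-- The Kronecker symbol `(d/a)` for arbitrary integers `d` and `a`: multiplicative in `a ≠ 0`
over the prime factorization of `|a|` (with multiplicity), with value the sign of `d` at `a = -1`, and
`(d/0) = 0` unless `d` is a unit. -/
def kroneckerSym (d a : ℤ) : ℤ :=
  if a = 0 then (if d = 1 ∨ d = -1 then 1 else 0)
  else (if a < 0 ∧ d < 0 then -1 else 1) *
    (a.natAbs.primeFactorsList.map (kroneckerPrime d)).prod

variable {G : Type*} [Group G]

/-- The map on conjugacy classes induced by `g ↦ g ^ a`. -/
def classPow (a : ℤ) : ConjClasses G → ConjClasses G :=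
  Quotient.map (fun g : G => g ^ a) fun g h hgh => by
    obtain ⟨c, hc⟩ := isConj_iff.1 hgh
    exact isConj_iff.2 ⟨c, by rw [← hc, conj_zpow]⟩

theorem classPow_mk (a : ℤ) (g : G) :
    classPow a (ConjClasses.mk g) = ConjClasses.mk (g ^ a) := rfl

theorem classPow_bijective [Finite G] {a : ℤ} (h : Int.gcd a (Nat.card G) = 1) :
    Function.Bijective (classPow a : ConjClasses G → ConjClasses G) := by
  have key : ∀ g : G, g ^ (a * Int.gcdA a (Nat.card G)) = g := by
    intro g
    have hb := Int.gcd_eq_gcd_ab a (Nat.card G)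
    rw [h] at hb
    have h1 : a * Int.gcdA a (Nat.card G) = 1 - Nat.card G * Int.gcdB a (Nat.card G) := by
      push_cast at hb
      linarith
    rw [h1, zpow_sub, zpow_mul, zpow_natCast, pow_card_eq_one']
    simp
  refine Function.bijective_iff_has_inverse.2 ⟨classPow (Int.gcdA a (Nat.card G)), ?_, ?_⟩
  · intro C
    induction C using Quotient.inductionOn with
    | _ g =>
      change ConjClasses.mk ((g ^ a) ^ _) = ConjClasses.mk g
      rw [← zpow_mul, key]
  · intro C
    induction C using Quotient.inductionOn with
    | _ g =>
      change ConjClasses.mk ((g ^ _) ^ a) = ConjClasses.mk g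
      rw [← zpow_mul, mul_comm, key]

/-- The permutation of the conjugacy classes induced by `g ↦ g ^ a`, for `a` prime to `|G|`. -/
noncomputable def classPerm [Finite G] (a : ℤ) (h : Int.gcd a (Nat.card G) = 1) :
    Equiv.Perm (ConjClasses G) :=
  Equiv.ofBijective (classPow a) (classPow_bijective h)

variable (G) in
open Classical in
/-- The quadratic symbol `(a/G)`: the sign of the permutation of the conjugacy classes induced
by `g ↦ g ^ a` if `a` is prime to `|G|`, and `0` otherwise. -/
noncomputable def quadSym [Finite G] (a : ℤ) : ℤ :=
  letI : Fintype (ConjClasses G) := Fintype.ofFinite _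
  if h : Int.gcd a (Nat.card G) = 1 then (Equiv.Perm.sign (classPerm a h) : ℤ) else 0

/-- A conjugacy class is real if it is mapped onto itself by `g ↦ g⁻¹`. -/
def IsRealClass (C : ConjClasses G) : Prop :=
  (fun g : G => g⁻¹) '' C.carrier = C.carrier

variable (G) in
/-- The number of real conjugacy classes. -/
noncomputable def numReal : ℕ := Nat.card {C : ConjClasses G // IsRealClass C}

variable (G) in
/-- Half the number of conjugacy classes that are not real. (For finite `G` that number is even,
see `card_conjClasses_eq`.) -/
noncomputable def numComplexPairs : ℕ := Nat.card {C : ConjClasses G // ¬ IsRealClass C} / 2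

variable (G) in
/-- `(-1) ^ r₂ * |G| ^ r₁ * ∏ |C|⁻¹`, the product over the real conjugacy classes, as a rational
number. -/
noncomputable def groupDisc : ℚ :=
  (-1) ^ numComplexPairs G * (Nat.card G : ℚ) ^ numReal G *
    ∏ᶠ C : {C : ConjClasses G // IsRealClass C}, ((C.1.carrier.ncard : ℚ))⁻¹

theorem classPow_classPow_neg_one (C : ConjClasses G) : classPow (-1) (classPow (-1) C) = C := by
  induction C using Quotient.inductionOn with
  | _ g =>
    change ConjClasses.mk ((g ^ (-1 : ℤ)) ^ (-1 : ℤ)) = ConjClasses.mk g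
    simp

theorem isRealClass_iff (C : ConjClasses G) : IsRealClass C ↔ classPow (-1) C = C := by
  have himg : (fun g : G => g⁻¹) '' C.carrier = (classPow (-1) C).carrier := by
    ext x
    constructor
    · rintro ⟨g, hg, rfl⟩
      have hg' := ConjClasses.mem_carrier_iff_mk_eq.1 hg
      rw [ConjClasses.mem_carrier_iff_mk_eq, ← hg', classPow_mk]
      simp
    · intro hx
      have hx' := ConjClasses.mem_carrier_iff_mk_eq.1 hx
      refine ⟨x⁻¹, ?_, by simp⟩
      rw [ConjClasses.mem_carrier_iff_mk_eq, ← classPow_classPow_neg_one C, ← hx', classPow_mk]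
      simp
  rw [IsRealClass, himg]
  constructor
  · intro h
    obtain ⟨x, hx⟩ := ConjClasses.exists_rep C
    have hm : x ∈ (classPow (-1) C).carrier := by
      rw [h]; exact ConjClasses.mem_carrier_iff_mk_eq.2 hx
    exact (ConjClasses.mem_carrier_iff_mk_eq.1 hm).symm.trans hx
  · intro h
    rw [h]

variable (G) in
/-- The number of conjugacy classes is `r₁ + 2 r₂`. -/
theorem card_conjClasses_eq [Finite G] :
    Nat.card (ConjClasses G) = numReal G + 2 * numComplexPairs G := by
  classical
  let _ : Fintype (ConjClasses G) := Fintype.ofFinite _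
  have hinv : Function.Involutive (classPow (-1) : ConjClasses G → ConjClasses G) :=
    classPow_classPow_neg_one
  have hmod := Equiv.Perm.card_fixedPoints_modEq (p := 2) (n := 1)
    (f := (classPow (-1) : ConjClasses G → ConjClasses G)) (by
      funext C
      exact hinv C)
  have hreal : Fintype.card (Function.fixedPoints (classPow (-1) : ConjClasses G → _)) =
      numReal G := by
    rw [numReal, ← Nat.card_eq_fintype_card]
    exact Nat.card_congr (Equiv.subtypeEquivRight fun C => (isRealClass_iff C).symm)
  have hsum : Nat.card (ConjClasses G) =
      numReal G + Nat.card {C : ConjClasses G // ¬ IsRealClass C} := by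
    rw [numReal, ← Nat.card_sum]
    exact Nat.card_congr (Equiv.sumCompl _).symm
  rw [hreal, ← Nat.card_eq_fintype_card] at hmod
  unfold numComplexPairs
  unfold Nat.ModEq at hmod
  omega

end GroupReciprocity

/-! Let `K` be an algebraic closure of `ZMod p`, with `p` prime to `|G|`. The group algebra over `K`
is a product of matrix algebras, and the traces of its blocks form a square character table `X`.
Column orthogonality says that `Xᵀ X` is the diagonal matrix of centralizer orders times the
permutation matrix of inversion, so `δ = det X` satisfies `δ² = (-1/G) ∏ |C_G(g)|`, the product
running over all classes. Frobenius sends the column of `C` to that of `C^p`, so `δ^p = (p/G) δ`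
(`exists_sqrt_disc`).

For odd `p`, Euler's criterion turns these two relations into `(δ²/p) = (p/G)`. The non-real classes
contribute pairs of equal factors to `δ²`, hence `(d/p) = (p/G)` (`legendreSym_intDisc_eq_quadSym`).

Multiplicativity extends this to odd positive moduli prime to `|G|`. Since `(·/G)` has period `|G|`,
which divides `d`, the arguments `-1` and `2` can be replaced by odd positive moduli, where Jacobi
reciprocity gives `d ≡ 1 mod 4` and `(2/G)` for odd `|G|`. For the last claim, a positive non-square
has Jacobi symbol `-1` at some odd modulus. -/

namespace Matrix

/-! ### Traces and Frobenius in characteristic `p`. -/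

open Polynomial in
/-- In characteristic `p`, the characteristic polynomial of `M ^ p` is the Frobenius twist of that
of `M`. -/
theorem charpoly_pow_char {n K : Type*} [DecidableEq n] [Fintype n] [Field K] (p : ℕ)
    [Fact p.Prime] [CharP K p] (M : Matrix n n K) :
    (M ^ p).charpoly = M.charpoly.map (frobenius K p) := by
  cases isEmpty_or_nonempty n
  · simp [charpoly]
  -- Substituting `X^p` for `X`, both sides become the `p`-th power of `det (X - M)`, because `X^p -
  -- M^p = (X - M)^p`.
  apply expand_injective (R := K) (Nat.Prime.pos (Fact.out : p.Prime))
  rw [← map_expand, map_frobenius_expand]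
  unfold charpoly
  rw [AlgHom.map_det, ← coe_detMonoidHom, ← (detMonoidHom : Matrix n n K[X] →* K[X]).map_pow]
  apply congr_arg det
  refine matPolyEquiv.injective ?_
  rw [map_pow, matPolyEquiv_charmatrix, sub_pow_char_of_commute, ← C_pow]
  · exact (id (matPolyEquiv_eq_X_pow_sub_C p M) :)
  · exact (C M).commute_X

/-- Up to sign the trace is a coefficient of the characteristic polynomial. This yields `χ(g)^p =
χ(g^p)` with no appeal to eigenvalues. -/
theorem trace_pow_char {n K : Type*} [DecidableEq n] [Fintype n] [Field K] (p : ℕ)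
    [Fact p.Prime] [CharP K p] (M : Matrix n n K) :
    trace (M ^ p) = trace M ^ p := by
  cases isEmpty_or_nonempty n
  · simp [Matrix.trace, (Nat.Prime.ne_zero (Fact.out : p.Prime))]
  rw [trace_eq_neg_charpoly_coeff, trace_eq_neg_charpoly_coeff, charpoly_pow_char,
    Polynomial.coeff_map, ← frobenius_def, map_neg]

end Matrix

/-! ### Traces of two-sided multiplication. -/

namespace GroupReciprocity

/-- The trace of `M ↦ A * M * B` on a product of matrix algebras. -/
theorem trace_mulLeft_mulRight_pi_matrix {ι K : Type*} [Fintype ι] [DecidableEq ι] [Field K]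
    {m : ι → Type*} [∀ i, Fintype (m i)] [∀ i, DecidableEq (m i)]
    (A B : Π i, Matrix (m i) (m i) K) :
    LinearMap.trace K _ (LinearMap.mulLeft K A ∘ₗ LinearMap.mulRight K B) =
      ∑ i, (A i).trace * (B i).trace := by
  rw [LinearMap.trace_eq_matrix_trace K (Pi.basis fun i => Matrix.stdBasis K (m i) (m i))]
  simp only [Matrix.trace, Matrix.diag_apply, LinearMap.toMatrix_apply, Fintype.sum_sigma,
    Fintype.sum_prod_type, Finset.sum_mul_sum]
  -- The `(a, b)` entry of `A E_ab B` is `A_aa * B_bb`.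
  refine Finset.sum_congr rfl fun i _ => Finset.sum_congr rfl fun a _ =>
    Finset.sum_congr rfl fun b _ => ?_
  have hrepr (M : Matrix (m i) (m i) K) :
      (Matrix.stdBasis K (m i) (m i)).repr M (a, b) = M a b := by
    simp [Matrix.stdBasis]
  rw [Pi.basis_repr, hrepr, Pi.basis_apply, Matrix.stdBasis_eq_single]
  simp only [LinearMap.comp_apply, LinearMap.mulLeft_apply, LinearMap.mulRight_apply,
    Pi.mul_apply, Pi.single_eq_same, ← mul_assoc]
  rw [Matrix.mul_apply, Finset.sum_eq_single b] <;> simp +contextual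

/-- The map permutes the basis `G` by `x ↦ g * x * h`, so its trace counts fixed points. Comparison
with the trace on matrix blocks gives column orthogonality over `K`. -/
theorem trace_mulLeft_mulRight_monoidAlgebra {K G : Type*} [Field K] [Group G] [Finite G]
    (g h : G) :
    LinearMap.trace K _ (LinearMap.mulLeft K (MonoidAlgebra.single g (1 : K)) ∘ₗ
      LinearMap.mulRight K (MonoidAlgebra.single h (1 : K))) =
      (Nat.card {x : G // g * x * h = x} : K) := by
  classical
  have : Fintype G := Fintype.ofFinite G
  rw [LinearMap.trace_eq_matrix_trace K (MonoidAlgebra.basis G K)]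
  simp only [Matrix.trace, Matrix.diag_apply, LinearMap.toMatrix_apply]
  simp [MonoidAlgebra.basis, MonoidAlgebra.single_mul_single, Finsupp.single_apply,
    Fintype.card_subtype, mul_assoc]

end GroupReciprocity

/-! ### Centralizers and the character table. -/

namespace GroupReciprocity

variable {G : Type*} [Group G]

/-- The order of the centralizer of an element of a conjugacy class. -/
noncomputable def centralizerCard (C : ConjClasses G) : ℕ :=
  Nat.card {x : G // x * Quotient.out C = Quotient.out C * x}

/-- The elements conjugating `g` to `h` form a coset of the centralizer of `g`. Orthogonality
produces such sets, not centralizers themselves. -/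
theorem card_conj_eq (g h : G) (hgh : IsConj g h) :
    Nat.card {x : G // x * g = h * x} = centralizerCard (ConjClasses.mk g) := by
  have hg : IsConj g (Quotient.out (ConjClasses.mk g)) := by
    rw [← ConjClasses.mk_eq_mk_iff_isConj]
    exact (Quotient.out_eq _).symm
  unfold centralizerCard
  generalize Quotient.out (ConjClasses.mk g) = k at hg
  obtain ⟨c, rfl⟩ := isConj_iff.1 hgh
  obtain ⟨b, rfl⟩ := isConj_iff.1 hg
  -- With `h = c g c⁻¹` and `k = b g b⁻¹`, the map `x ↦ b c⁻¹ x b⁻¹` lands in the centralizer of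
  -- `k`.
  refine Nat.card_congr (((Equiv.mulLeft (b * c⁻¹)).trans (Equiv.mulRight b⁻¹)).subtypeEquiv
    fun x => ?_)
  simp only [Equiv.trans_apply, Equiv.coe_mulLeft, Equiv.coe_mulRight]
  constructor
  · intro h
    have h' : x * g * b⁻¹ = c * g * c⁻¹ * x * b⁻¹ := by rw [h]
    simp only [mul_assoc, inv_mul_cancel_left] at h' ⊢
    rw [h']
    simp only [inv_mul_cancel_left]
  · intro h
    have h' := congrArg (fun y => c * b⁻¹ * y * b) h
    simpa [mul_assoc] using h'

theorem centralizerCard_mk (g : G) :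
    centralizerCard (ConjClasses.mk g) = Nat.card {x : G // x * g = g * x} :=
  (card_conj_eq g g (IsConj.refl g)).symm

theorem ncard_carrier_mul_centralizerCard [Finite G] (C : ConjClasses G) :
    C.carrier.ncard * centralizerCard C = Nat.card G := by
  obtain ⟨g, rfl⟩ := ConjClasses.exists_rep C
  have h1 : centralizerCard (ConjClasses.mk g) =
      Nat.card (MulAction.stabilizer (ConjAct G) g) := by
    rw [centralizerCard_mk, ← Subgroup.nat_card_centralizer_nat_card_stabilizer]
    refine Nat.card_congr (Equiv.subtypeEquivRight fun x => ?_)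
    rw [Subgroup.mem_centralizer_singleton_iff]
  rw [h1, ← ConjAct.orbit_eq_carrier_conjClasses,
    ← MulAction.index_stabilizer, mul_comm, Subgroup.card_mul_index]
  rfl

/-- The character table over an algebraically closed field `K` in which `|G|` is invertible: a square
matrix satisfying column orthogonality, and compatible with Frobenius in characteristic `p`. -/
theorem exists_charTable (K : Type*) [Field K] [IsAlgClosed K] [Finite G]
    [NeZero (Nat.card G : K)] [Fintype (ConjClasses G)] [DecidableEq (ConjClasses G)] :
    ∃ X : Matrix (ConjClasses G) (ConjClasses G) K,
      (∀ C D, ∑ i, X i C * X i D =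
        if D = classPow (-1) C then (centralizerCard C : K) else 0) ∧
      ∀ (p : ℕ) [Fact p.Prime] [CharP K p], ∀ i C, X i C ^ p = X i (classPow p C) := by
  classical
  have : Fintype G := Fintype.ofFinite G
  obtain ⟨n, d, hd, ⟨e⟩⟩ := IsSemisimpleRing.exists_algEquiv_pi_matrix_of_isAlgClosed K
    (MonoidAlgebra K G)
  let of (g : G) : MonoidAlgebra K G := MonoidAlgebra.single g 1
  have of_mul (g h : G) : of (g * h) = of g * of h := by simp [of]
  let χ (i : Fin n) (g : G) : K := (e (of g) i).trace
  have χ_conj (i : Fin n) (g h : G) (hgh : IsConj g h) : χ i g = χ i h := by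
    obtain ⟨c, rfl⟩ := isConj_iff.1 hgh
    simp only [χ]
    rw [of_mul, map_mul, Pi.mul_apply, Matrix.trace_mul_comm, ← Pi.mul_apply, ← map_mul, ← of_mul,
      inv_mul_cancel_left]
  have χ_pow (p : ℕ) [Fact p.Prime] [CharP K p] (i : Fin n) (g : G) :
      χ i g ^ p = χ i (g ^ p) := by
    have : of (g ^ p) = of g ^ p := by simp [of, MonoidAlgebra.single_pow]
    simp only [χ, this, map_pow, Pi.pow_apply, Matrix.trace_pow_char]
  -- The trace of `x ↦ g x h`, computed on the blocks and on the basis `G`.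
  have χ_orth (g h : G) : ∑ i, χ i g * χ i h =
      (Nat.card {x : G // g * x * h = x} : K) := by
    rw [← trace_mulLeft_mulRight_monoidAlgebra, ← trace_mulLeft_mulRight_pi_matrix,
      ← LinearMap.trace_conj' _ e.toLinearEquiv]
    congr 1
    refine LinearMap.ext fun x => ?_
    simp [LinearEquiv.conj_apply, of]
  let Y : Matrix (Fin n) (ConjClasses G) K := fun i C => Quotient.lift (χ i) (χ_conj i) C
  have Y_mk (i : Fin n) (g : G) : Y i (ConjClasses.mk g) = χ i g := rfl
  have Y_orth (C D : ConjClasses G) : ∑ i, Y i C * Y i D =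
      if D = classPow (-1) C then (centralizerCard C : K) else 0 := by
    obtain ⟨g, rfl⟩ := ConjClasses.exists_rep C
    obtain ⟨h, rfl⟩ := ConjClasses.exists_rep D
    simp only [Y_mk, χ_orth, classPow_mk, zpow_neg_one]
    have hset : {x : G // g * x * h = x} = {x : G // x * h⁻¹ = g * x} := by
      congr 1
      ext1 x
      rw [eq_iff_iff, mul_inv_eq_iff_eq_mul, eq_comm]
    have hiff : ConjClasses.mk h = ConjClasses.mk g⁻¹ ↔ IsConj h⁻¹ g := by
      rw [ConjClasses.mk_eq_mk_iff_isConj, isConj_iff, isConj_iff]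
      refine exists_congr fun c => ?_
      rw [← conj_inv, inv_eq_iff_eq_inv]
    rw [hset]
    split_ifs with hc
    · rw [hiff] at hc
      rw [card_conj_eq _ _ hc, ConjClasses.mk_eq_mk_iff_isConj.2 hc]
    · rw [hiff] at hc
      have : IsEmpty {x : G // x * h⁻¹ = g * x} :=
        ⟨fun x => hc (isConj_iff.2 ⟨x, by rw [x.2, mul_inv_cancel_right]⟩)⟩
      simp
  have Y_pow (p : ℕ) [Fact p.Prime] [CharP K p] (i : Fin n) (C : ConjClasses G) :
      Y i C ^ p = Y i (classPow p C) := by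
    obtain ⟨g, rfl⟩ := ConjClasses.exists_rep C
    rw [classPow_mk, zpow_natCast, Y_mk, Y_mk, χ_pow]
  -- The characters are independent: a relation extends linearly to the whole group algebra, where
  -- it is tested on a diagonal matrix unit of block `i`.
  have card_le : n ≤ Fintype.card (ConjClasses G) := by
    have : LinearIndependent K Y := by
      rw [Fintype.linearIndependent_iff]
      intro c hc i
      have hzero (x : MonoidAlgebra K G) : ∑ j, c j * (e x j).trace = 0 := by
        induction x using MonoidAlgebra.induction_linear with
        | zero => simp
        | add x y hx hy => simp [mul_add, Finset.sum_add_distrib, hx, hy]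
        | single g a =>
          have hs : MonoidAlgebra.single g a = a • of g := by simp [of]
          have := congrFun hc (ConjClasses.mk g)
          simp only [Finset.sum_apply, Pi.smul_apply, smul_eq_mul, Pi.zero_apply] at this
          simp only [hs, map_smul, Pi.smul_apply, Matrix.trace_smul, smul_eq_mul,
            mul_left_comm _ a, ← Finset.mul_sum]
          exact mul_eq_zero_of_right a this
      have := hzero (e.symm (Pi.single i (Matrix.single 0 0 1)))
      rw [Finset.sum_eq_single i] at this
      · simpa using this
      · intro j _ hj
        simp [Pi.single_eq_of_ne hj]
      · simp
    simpa using this.fintype_card_le_finrank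
  -- The columns are independent: pairing a relation with the column of the inverse class isolates
  -- one coefficient times a centralizer order, which divides `|G|` and so is nonzero in `K`.
  have le_card : Fintype.card (ConjClasses G) ≤ n := by
    have : LinearIndependent K fun C i => Y i C := by
      rw [Fintype.linearIndependent_iff]
      intro c hc C
      have hY (i : Fin n) : ∑ D, c D * Y i D = 0 := by
        simpa using congrFun hc i
      have hsum : ∑ D, c D * ∑ i, Y i (classPow (-1) C) * Y i D = 0 := by
        simp only [Finset.mul_sum]
        rw [Finset.sum_comm]
        refine Finset.sum_eq_zero fun i _ => ?_
        simp only [mul_left_comm (c _), ← Finset.mul_sum, hY, mul_zero]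
      simp only [Y_orth, classPow_classPow_neg_one] at hsum
      have hz : (centralizerCard (classPow (-1) C) : K) ≠ 0 := by
        intro h0
        apply NeZero.ne (Nat.card G : K)
        rw [← ncard_carrier_mul_centralizerCard (classPow (-1) C), Nat.cast_mul, h0, mul_zero]
      simpa [hz] using hsum
    simpa using this.fintype_card_le_finrank
  -- An arbitrary labelling of the rows by classes; it affects the determinant only by a sign.
  let f : ConjClasses G ≃ Fin n := Fintype.equivFinOfCardEq (le_antisymm le_card card_le)
  refine ⟨Y.submatrix f id, fun C D => ?_, fun p _ _ i C => Y_pow p (f i) C⟩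
  rw [← Y_orth, ← f.sum_comp]
  rfl

end GroupReciprocity

/-! ### Multiplicativity and periodicity of the symbol `(a/G)`. -/

namespace GroupReciprocity

theorem gcd_mul_eq_one {a b n : ℤ} (ha : Int.gcd a n = 1) (hb : Int.gcd b n = 1) :
    Int.gcd (a * b) n = 1 := by
  rw [← Int.isCoprime_iff_gcd_eq_one] at *
  exact ha.mul_left hb

theorem gcd_neg_one_left_eq (n : ℤ) : Int.gcd (-1) n = 1 := by simp

theorem classPow_mul {G : Type*} [Group G] (a b : ℤ) (C : ConjClasses G) :
    classPow (a * b) C = classPow a (classPow b C) := by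
  obtain ⟨g, rfl⟩ := ConjClasses.exists_rep C
  rw [classPow_mk, classPow_mk, classPow_mk, mul_comm, zpow_mul]

theorem centralizerCard_classPow_neg_one {G : Type*} [Group G] (C : ConjClasses G) :
    centralizerCard (classPow (-1) C) = centralizerCard C := by
  obtain ⟨g, rfl⟩ := ConjClasses.exists_rep C
  rw [classPow_mk, centralizerCard_mk, centralizerCard_mk]
  refine Nat.card_congr (Equiv.subtypeEquivRight fun x => ?_)
  rw [zpow_neg_one]
  exact Commute.inv_right_iff

section Symbol

variable {G : Type*} [Group G] [Finite G]

theorem quadSym_eq_sign [Fintype (ConjClasses G)] [DecidableEq (ConjClasses G)] {a : ℤ}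
    (h : Int.gcd a (Nat.card G) = 1) :
    quadSym G a = (Equiv.Perm.sign (classPerm (G := G) a h) : ℤ) := by
  simp only [quadSym, dif_pos h]
  congr!

theorem quadSym_mul {a b : ℤ} (ha : Int.gcd a (Nat.card G) = 1)
    (hb : Int.gcd b (Nat.card G) = 1) : quadSym G (a * b) = quadSym G a * quadSym G b := by
  classical
  have : Fintype (ConjClasses G) := Fintype.ofFinite _
  rw [quadSym_eq_sign (gcd_mul_eq_one ha hb), quadSym_eq_sign ha, quadSym_eq_sign hb,
    ← Units.val_mul, ← map_mul]
  congr 2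
  ext C
  exact classPow_mul a b C

theorem quadSym_one : quadSym G 1 = 1 := by
  classical
  have : Fintype (ConjClasses G) := Fintype.ofFinite _
  have h1 : Int.gcd 1 (Nat.card G) = 1 := by simp
  have : classPerm (G := G) 1 h1 = 1 := by
    ext C
    obtain ⟨g, rfl⟩ := ConjClasses.exists_rep C
    exact congrArg ConjClasses.mk (zpow_one g)
  rw [quadSym_eq_sign h1, this]
  simp

theorem quadSym_congr {a b : ℤ} (h : a ≡ b [ZMOD Nat.card G]) : quadSym G a = quadSym G b := by
  classical
  have : Fintype (ConjClasses G) := Fintype.ofFinite _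
  have hgcd : Int.gcd a (Nat.card G) = Int.gcd b (Nat.card G) := by
    rw [← Int.gcd_emod, h, Int.gcd_emod]
  by_cases ha : Int.gcd a (Nat.card G) = 1
  · have hb := hgcd.symm.trans ha
    rw [quadSym_eq_sign ha, quadSym_eq_sign hb]
    congr 2
    ext C
    obtain ⟨g, rfl⟩ := ConjClasses.exists_rep C
    refine congrArg ConjClasses.mk (zpow_eq_zpow_iff_modEq.2 ?_)
    exact h.of_dvd (Int.natCast_dvd_natCast.2 (orderOf_dvd_natCard g))
  · have hb := hgcd ▸ ha
    simp [quadSym, ha, hb]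

/-- Inversion acts on the classes as `r₂` disjoint transpositions. -/
theorem quadSym_neg_one : quadSym G (-1) = (-1) ^ numComplexPairs G := by
  classical
  have : Fintype (ConjClasses G) := Fintype.ofFinite _
  rw [quadSym_eq_sign (gcd_neg_one_left_eq _), Equiv.Perm.sign_of_pow_two_eq_one]
  · have hreal : Fintype.card (Function.fixedPoints (classPerm (-1) (gcd_neg_one_left_eq (Nat.card G)))) =
        numReal G := by
      rw [numReal, ← Nat.card_eq_fintype_card]
      exact Nat.card_congr (Equiv.subtypeEquivRight fun C => (isRealClass_iff C).symm)
    rw [hreal, ← Nat.card_eq_fintype_card, card_conjClasses_eq, Nat.add_sub_cancel_left,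
      Nat.mul_div_cancel_left _ two_pos]
    simp
  · ext C
    exact classPow_classPow_neg_one C

theorem quadSym_natCast_eq_prod {n : ℕ} (hn : n ≠ 0) (h : Int.gcd n (Nat.card G) = 1) :
    quadSym G n = (n.primeFactorsList.map fun p : ℕ => quadSym G p).prod := by
  induction n using Nat.recOnMul with
  | zero => exact absurd rfl hn
  | one => simp [quadSym_one]
  | prime p hp => simp [Nat.primeFactorsList_prime hp]
  | mul a b ha hb =>
    obtain ⟨ha0, hb0⟩ := mul_ne_zero_iff.1 hn
    rw [Nat.cast_mul, ← Int.isCoprime_iff_gcd_eq_one, IsCoprime.mul_left_iff,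
      Int.isCoprime_iff_gcd_eq_one, Int.isCoprime_iff_gcd_eq_one] at h
    rw [Nat.cast_mul, quadSym_mul h.1 h.2, ha ha0 h.1, hb hb0 h.2,
      ((Nat.perm_primeFactorsList_mul ha0 hb0).map _).prod_eq, List.map_append, List.prod_append]

end Symbol

/-! ### The discriminant and the determinant of the character table. -/

section Discriminant

variable (G : Type*) [Group G]

/-- The discriminant `(-1) ^ r₂ * ∏ |C_G(g)|`, over representatives `g` of the real classes, as an
integer. -/
noncomputable def intDisc : ℤ :=
  (-1) ^ numComplexPairs G * ∏ᶠ C : {C : ConjClasses G // IsRealClass C}, (centralizerCard C.1 : ℤ)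

variable [Finite G]

theorem centralizerCard_dvd_card (C : ConjClasses G) : centralizerCard C ∣ Nat.card G :=
  ⟨_, (ncard_carrier_mul_centralizerCard C).symm.trans (mul_comm _ _)⟩

theorem centralizerCard_ne_zero (C : ConjClasses G) : centralizerCard C ≠ 0 :=
  ne_zero_of_dvd_ne_zero Nat.card_pos.ne' (centralizerCard_dvd_card G C)

theorem intDisc_ne_zero : intDisc G ≠ 0 := by
  have : Fintype {C : ConjClasses G // IsRealClass C} := Fintype.ofFinite _
  rw [intDisc, finprod_eq_prod_of_fintype]
  refine mul_ne_zero (by simp) (Finset.prod_ne_zero_iff.2 fun C _ => ?_)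
  exact_mod_cast centralizerCard_ne_zero G C.1

theorem intDisc_cast : (intDisc G : ℚ) = groupDisc G := by
  have : Fintype {C : ConjClasses G // IsRealClass C} := Fintype.ofFinite _
  rw [intDisc, groupDisc, finprod_eq_prod_of_fintype, finprod_eq_prod_of_fintype, mul_assoc,
    numReal, Nat.card_eq_fintype_card (α := {C : ConjClasses G // IsRealClass C}),
    ← Finset.card_univ, ← Finset.prod_const, ← Finset.prod_mul_distrib]
  push_cast
  congr 1
  refine Finset.prod_congr rfl fun C _ => ?_
  have h := ncard_carrier_mul_centralizerCard C.1
  have h0 : C.1.carrier.ncard ≠ 0 := left_ne_zero_of_mul (h ▸ Nat.card_pos.ne')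
  rw [← h]
  push_cast
  field_simp

/-- The class of the identity is real with centralizer `G`. Congruences modulo `d` therefore descend
to the period `|G|` of the symbol. -/
theorem card_dvd_intDisc : (Nat.card G : ℤ) ∣ intDisc G := by
  have : Fintype {C : ConjClasses G // IsRealClass C} := Fintype.ofFinite _
  rw [intDisc, finprod_eq_prod_of_fintype]
  refine Dvd.dvd.mul_left ?_ _
  have hreal : IsRealClass (ConjClasses.mk (1 : G)) := by
    rw [isRealClass_iff, classPow_mk, one_zpow]
  have hcard : centralizerCard (ConjClasses.mk (1 : G)) = Nat.card G := by
    rw [centralizerCard_mk]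
    exact Nat.card_congr (Equiv.subtypeUnivEquiv fun x => by simp)
  have hdvd := Finset.dvd_prod_of_mem (fun C : {C : ConjClasses G // IsRealClass C} =>
    (centralizerCard C.1 : ℤ)) (Finset.mem_univ ⟨_, hreal⟩)
  rwa [hcard] at hdvd

/-- By Cauchy there is an involution `t`. The classes of `1` and `t` are real and distinct, and both
centralizers contain `t`, so each contributes a factor `2`. -/
theorem four_dvd_intDisc (h : 2 ∣ Nat.card G) : 4 ∣ intDisc G := by
  classical
  have : Fintype {C : ConjClasses G // IsRealClass C} := Fintype.ofFinite _
  have : Fact (Nat.Prime 2) := ⟨Nat.prime_two⟩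
  obtain ⟨t, ht⟩ := exists_prime_orderOf_dvd_card' 2 h
  have ht1 : t ≠ 1 := by
    rintro rfl
    simp at ht
  have ht2 : t⁻¹ = t := by
    rw [inv_eq_iff_mul_eq_one, ← sq, ← ht, pow_orderOf_eq_one]
  have hreal (s : G) (hs : s⁻¹ = s) : IsRealClass (ConjClasses.mk s) := by
    rw [isRealClass_iff, classPow_mk, zpow_neg_one, hs]
  have heven (s : G) (hs : Commute t s) : (2 : ℤ) ∣ centralizerCard (ConjClasses.mk s) := by
    have : centralizerCard (ConjClasses.mk s) = Nat.card (Subgroup.centralizer {s}) := by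
      rw [centralizerCard_mk]
      refine Nat.card_congr (Equiv.subtypeEquivRight fun x => ?_)
      rw [Subgroup.mem_centralizer_singleton_iff]
    rw [this]
    have hmem : t ∈ Subgroup.centralizer {s} := Subgroup.mem_centralizer_singleton_iff.2 hs
    have := Subgroup.orderOf_dvd_natCard (Subgroup.centralizer {s}) hmem
    rw [ht] at this
    exact_mod_cast this
  rw [intDisc, finprod_eq_prod_of_fintype]
  refine Dvd.dvd.mul_left ?_ _
  let c1 : {C : ConjClasses G // IsRealClass C} := ⟨_, hreal 1 inv_one⟩
  let ct : {C : ConjClasses G // IsRealClass C} := ⟨_, hreal t ht2⟩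
  have hne : ct ≠ c1 := by
    intro h
    have := congrArg Subtype.val h
    rw [ConjClasses.mk_eq_mk_iff_isConj] at this
    exact ht1 (isConj_one_left.1 this)
  have hpair : ∏ C ∈ {ct, c1}, (centralizerCard C.1 : ℤ) ∣
      ∏ C : {C : ConjClasses G // IsRealClass C}, (centralizerCard C.1 : ℤ) :=
    Finset.prod_dvd_prod_of_subset _ _ _ (Finset.subset_univ _)
  rw [Finset.prod_pair hne] at hpair
  refine dvd_trans ?_ hpair
  exact mul_dvd_mul (heven t (Commute.refl t)) (heven 1 (Commute.one_right t))

theorem sign_intDisc : intDisc G < 0 ↔ quadSym G (-1) = -1 := by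
  have : Fintype {C : ConjClasses G // IsRealClass C} := Fintype.ofFinite _
  have hpos : (0 : ℤ) < ∏ C : {C : ConjClasses G // IsRealClass C}, (centralizerCard C.1 : ℤ) :=
    Finset.prod_pos fun C _ => by exact_mod_cast (centralizerCard_ne_zero G C.1).bot_lt
  rw [quadSym_neg_one, intDisc, finprod_eq_prod_of_fintype]
  rcases neg_one_pow_eq_or ℤ (numComplexPairs G) with h | h <;> rw [h]
  · simp [hpos.le]
  · simp [hpos]

/-- `C` and `C⁻¹` have equal centralizer orders, so each non-real pair contributes a square prime to
`p`. The product over real classes may thus be exchanged for the one over all classes, which the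
determinant provides. -/
theorem legendreSym_intDisc (p : ℕ) [Fact p.Prime] (hp : ¬ p ∣ Nat.card G) :
    legendreSym p (intDisc G) = legendreSym p (quadSym G (-1)) *
      ∏ᶠ C : ConjClasses G, legendreSym p (centralizerCard C) := by
  classical
  have : Fintype (ConjClasses G) := Fintype.ofFinite _
  rw [intDisc, finprod_eq_prod_of_fintype, finprod_eq_prod_of_fintype, legendreSym.mul,
    ← quadSym_neg_one, ← Finset.prod_filter_mul_prod_filter_not Finset.univ
      (fun C : ConjClasses G => IsRealClass C), Finset.prod_subtype (p := fun C => IsRealClass C)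
      (F := inferInstance) _ (by simp)]
  have hns : ∏ C : ConjClasses G with ¬ IsRealClass C, legendreSym p (centralizerCard C) = 1 := by
    refine Finset.prod_involution (fun C _ => classPow (-1) C) ?_ ?_ ?_ ?_
    · intro C _
      rw [centralizerCard_classPow_neg_one, ← sq]
      refine legendreSym.sq_one p ?_
      rw [Int.cast_natCast, Ne, ZMod.natCast_eq_zero_iff]
      exact fun h => hp (h.trans (centralizerCard_dvd_card G C))
    · intro C hC _ h
      exact (Finset.mem_filter.1 hC).2 ((isRealClass_iff C).2 h)
    · intro C hC
      simp only [Finset.mem_filter, Finset.mem_univ, true_and, isRealClass_iff,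
        classPow_classPow_neg_one] at hC ⊢
      exact fun h => hC h.symm
    · intro C _
      exact classPow_classPow_neg_one C
  rw [hns, mul_one]
  congr 1
  exact map_prod (legendreSym.hom p) _ _

/-- The determinant of the character table over an algebraically closed field of characteristic `p`
prime to `|G|`: its square, and the action of Frobenius on it. -/
theorem exists_sqrt_disc (K : Type*) [Field K] [IsAlgClosed K] (p : ℕ) [Fact p.Prime] [CharP K p]
    (hp : ¬ p ∣ Nat.card G) [Fintype (ConjClasses G)] :
    ∃ δ : K, δ ^ 2 = ((quadSym G (-1) * ∏ C : ConjClasses G, (centralizerCard C : ℤ) : ℤ) : K) ∧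
      δ ^ p = (quadSym G p : K) * δ := by
  classical
  have hgcd : Int.gcd p (Nat.card G) = 1 :=
    (Nat.Prime.coprime_iff_not_dvd (Fact.out : p.Prime)).2 hp
  have : NeZero (Nat.card G : K) := ⟨fun h => hp ((CharP.cast_eq_zero_iff K p _).1 h)⟩
  obtain ⟨X, hX, hXp⟩ := exists_charTable (G := G) K
  refine ⟨X.det, ?_, ?_⟩
  -- Column orthogonality in matrix form.
  · have hmul : X.transpose * X = Matrix.diagonal (fun C => (centralizerCard C : K)) *
        (classPerm (G := G) (-1) (gcd_neg_one_left_eq _)).permMatrix K := by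
      ext C E
      rw [Matrix.mul_apply, Matrix.diagonal_mul]
      simp only [Matrix.transpose_apply, hX, Equiv.Perm.permMatrix, PEquiv.toMatrix_apply,
        Equiv.toPEquiv_apply, Option.mem_def, Option.some_inj, mul_ite, mul_one, mul_zero]
      exact if_congr eq_comm rfl rfl
    have := congrArg Matrix.det hmul
    rw [Matrix.det_mul, Matrix.det_transpose, Matrix.det_mul, Matrix.det_diagonal,
      Matrix.det_permutation] at this
    rw [sq, this, mul_comm, quadSym_eq_sign (gcd_neg_one_left_eq _)]
    push_cast
    rfl
  -- Frobenius applied entrywise permutes the columns of `X` by `C ↦ C^p`.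
  · rw [quadSym_eq_sign hgcd, ← Matrix.det_permute', ← frobenius_def, RingHom.map_det]
    congr 1
    ext i C
    exact hXp p i C

theorem quadSym_eq_one_or_neg_one {a : ℤ} (h : Int.gcd a (Nat.card G) = 1) :
    quadSym G a = 1 ∨ quadSym G a = -1 := by
  classical
  have : Fintype (ConjClasses G) := Fintype.ofFinite _
  rw [quadSym_eq_sign h]
  rcases Int.units_eq_one_or (Equiv.Perm.sign (classPerm (G := G) a h)) with h | h <;> simp [h]

/-- Euler's criterion: `D = δ²` gives `D^((p-1)/2) = δ^(p-1) = (p/G)` in `ZMod p`, and `1 ≠ -1`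
there because `p` is odd. -/
theorem legendreSym_intDisc_eq_quadSym (p : ℕ) [Fact p.Prime] (hp2 : p ≠ 2)
    (hp : ¬ p ∣ Nat.card G) : legendreSym p (intDisc G) = quadSym G p := by
  have : Fintype (ConjClasses G) := Fintype.ofFinite _
  have hprime : p.Prime := Fact.out
  have hodd := hprime.mod_two_eq_one_iff_ne_two.2 hp2
  have hgcd : Int.gcd p (Nat.card G) = 1 := (Nat.Prime.coprime_iff_not_dvd hprime).2 hp
  obtain ⟨δ, hδ, hδp⟩ := exists_sqrt_disc G (AlgebraicClosure (ZMod p)) p hp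
  have hz (C : ConjClasses G) : ((centralizerCard C : ℤ) : ZMod p) ≠ 0 := by
    rw [Int.cast_natCast, Ne, ZMod.natCast_eq_zero_iff]
    exact fun h => hp (h.trans (centralizerCard_dvd_card G C))
  have hleg : legendreSym p (intDisc G) =
      legendreSym p (quadSym G (-1) * ∏ C : ConjClasses G, (centralizerCard C : ℤ)) := by
    rw [legendreSym_intDisc G p hp, legendreSym.mul, finprod_eq_prod_of_fintype]
    congr 1
    exact (map_prod (legendreSym.hom p) _ _).symm
  rw [hleg]
  generalize hD : quadSym G (-1) * ∏ C : ConjClasses G, (centralizerCard C : ℤ) = D at hδ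
  have hD0 : (D : ZMod p) ≠ 0 := by
    rw [← hD, Int.cast_mul, Int.cast_prod]
    refine mul_ne_zero ?_ (Finset.prod_ne_zero_iff.2 fun C _ => hz C)
    rcases quadSym_eq_one_or_neg_one G (gcd_neg_one_left_eq (Nat.card G)) with h | h <;> simp [h]
  have hδ0 : δ ≠ 0 := by
    rintro rfl
    apply hD0
    apply (algebraMap (ZMod p) (AlgebraicClosure (ZMod p))).injective
    rw [map_intCast, map_zero, ← hδ, zero_pow two_ne_zero]
  have hpow : (D : ZMod p) ^ (p / 2) = (quadSym G p : ZMod p) := by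
    apply (algebraMap (ZMod p) (AlgebraicClosure (ZMod p))).injective
    rw [map_pow, map_intCast, map_intCast, ← hδ, ← pow_mul]
    apply mul_right_cancel₀ hδ0
    rw [← hδp, ← pow_succ]
    congr 1
    omega
  rw [← legendreSym.eq_pow] at hpow
  have : Fact (2 < p) := ⟨lt_of_le_of_ne hprime.two_le hp2.symm⟩
  have hne := ZMod.neg_one_ne_one (n := p)
  rcases legendreSym.eq_one_or_neg_one p hD0 with h1 | h1 <;>
  rcases quadSym_eq_one_or_neg_one G hgcd with h2 | h2 <;>
  rw [h1, h2] at hpow ⊢ <;> simp only [Int.cast_one, Int.cast_neg] at hpow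
  · exact absurd hpow.symm hne
  · exact absurd hpow hne

end Discriminant

end GroupReciprocity

namespace GroupReciprocity

/-! ### Jacobi symbols of non-squares. -/

section NonSquare

theorem exists_prime_odd_factorization {n : ℕ} (hn : n ≠ 0) (hsq : ¬ IsSquare n) :
    ∃ p, p.Prime ∧ Odd (n.factorization p) := by
  by_contra! h
  apply hsq
  rw [← Nat.prod_factorization_pow_eq_self hn]
  refine Finset.isSquare_prod _ fun p hp => ?_
  exact (Nat.not_odd_iff_even.1 (h p (Nat.prime_of_mem_primeFactors hp))).isSquare_pow p

-- Used to neutralise the part of `d` prime to a chosen prime `q`, so that only `q` affects the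
-- symbol.
open NumberTheorySymbols in
theorem jacobiSym_eq_one_of_modEq_one {n m : ℕ} (hn : Odd n) (hm : m % 4 = 1)
    (h : m ≡ 1 [MOD n]) : J(n | m) = 1 := by
  rw [jacobiSym.quadratic_reciprocity_one_mod_four' hn hm, jacobiSym.mod_left' (a₂ := 1),
    jacobiSym.one_left]
  exact_mod_cast h

open NumberTheorySymbols in
/-- A natural number that is not a square has Jacobi symbol `-1` at some odd modulus. -/
theorem exists_jacobiSym_eq_neg_one {d : ℕ} (hd : d ≠ 0) (hsq : ¬ IsSquare d) :
    ∃ m : ℕ, Odd m ∧ J(d | m) = -1 := by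
  obtain ⟨q, hq, hodd⟩ := exists_prime_odd_factorization hd hsq
  have hdr : q ^ d.factorization q * (d / q ^ d.factorization q) = d :=
    Nat.ordProj_mul_ordCompl_eq_self d q
  have hqr : ¬ q ∣ d / q ^ d.factorization q := Nat.not_dvd_ordCompl hq hd
  generalize d / q ^ d.factorization q = r at hdr hqr
  generalize d.factorization q = j at hdr hodd
  subst hdr
  obtain ⟨hq0, hr⟩ := mul_ne_zero_iff.1 hd
  rcases eq_or_ne q 2 with rfl | hq2
  · have hr2 : Odd r := Nat.odd_iff.2 (Nat.two_dvd_ne_zero.1 hqr)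
    have hco : Nat.Coprime 8 r := Nat.Coprime.pow_left 3 (Nat.coprime_two_left.2 hr2)
    -- `m ≡ 5 mod 8` gives both `(2/m) = -1` and `m ≡ 1 mod 4`; `m ≡ 1 mod r` then gives `(r/m) =
    -- 1`.
    obtain ⟨m, hm8, hmr⟩ := Nat.chineseRemainder hco 5 1
    have hm8' : m % 8 = 5 := hm8
    have hm : Odd m := Nat.odd_iff.2 (by omega)
    refine ⟨m, hm, ?_⟩
    have h2 : J(2 | m) = -1 := by
      rw [jacobiSym.at_two hm, ZMod.χ₈_nat_eq_if_mod_eight]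
      simp [hm8', show m % 2 ≠ 0 by omega]
    push_cast
    rw [jacobiSym.mul_left, jacobiSym.pow_left, h2, hodd.neg_one_pow,
      jacobiSym_eq_one_of_modEq_one hr2 (by omega) hmr, mul_one]
  · have hqo : Odd q := hq.odd_of_ne_two hq2
    have : Fact q.Prime := ⟨hq⟩
    obtain ⟨k, n, hn, rfl⟩ := Nat.exists_eq_two_pow_mul_odd hr
    have hqn : ¬ q ∣ n := fun h => hqr (h.mul_left _)
    have hco : Nat.Coprime (8 * n) q :=
      Nat.Coprime.mul_left (Nat.Coprime.pow_left 3 (Nat.coprime_two_left.2 hqo))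
        ((Nat.Prime.coprime_iff_not_dvd hq).2 hqn).symm
    obtain ⟨u, hu⟩ := FiniteField.exists_nonsquare (F := ZMod q) (by rwa [ZMod.ringChar_zmod_n])
    -- `m ≡ 1 mod 8n` makes the symbols of `2` and `n` trivial, while a non-residue modulo `q` gives
    -- `(q/m) = (m/q) = -1`.
    obtain ⟨m, hm, hmq⟩ := Nat.chineseRemainder hco 1 u.val
    have hm8 : m % 8 = 1 := hm.of_mul_right n
    have hmo : Odd m := Nat.odd_iff.2 (by omega)
    refine ⟨m, hmo, ?_⟩
    have h2 : J(2 | m) = 1 := by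
      rw [jacobiSym.at_two hmo, ZMod.χ₈_nat_eq_if_mod_eight]
      simp [hm8, show m % 2 ≠ 0 by omega]
    have hq' : J(q | m) = -1 := by
      rw [jacobiSym.quadratic_reciprocity_one_mod_four' hqo (by omega),
        ← jacobiSym.legendreSym.to_jacobiSym, legendreSym.eq_neg_one_iff']
      rwa [(ZMod.natCast_eq_natCast_iff _ _ _).2 hmq, ZMod.natCast_zmod_val]
    push_cast
    rw [jacobiSym.mul_left, jacobiSym.mul_left, jacobiSym.pow_left, jacobiSym.pow_left, h2, hq',
      hodd.neg_one_pow, jacobiSym_eq_one_of_modEq_one hn (by omega) (hm.of_mul_left 8), one_pow,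
      mul_one, mul_one]

end NonSquare

theorem not_dvd_of_mem_primeFactorsList {n : ℕ} {a : ℤ} (ha : Int.gcd a (n) = 1) {p : ℕ}
    (hp : p ∈ a.natAbs.primeFactorsList) : ¬ p ∣ n := fun h =>
  (Nat.prime_of_mem_primeFactorsList hp).one_lt.ne'
    (Nat.eq_one_of_dvd_one (ha ▸ Nat.dvd_gcd (Nat.dvd_of_mem_primeFactorsList hp) h))

/-! ### Reciprocity for all integers, and triviality of the symbol. -/

section Reciprocity

variable (G : Type*) [Group G] [Finite G]

open NumberTheorySymbols

theorem jacobiSym_intDisc {m : ℕ} (hm : Odd m) (h : Int.gcd m (Nat.card G) = 1) :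
    J(intDisc G | m) = quadSym G m := by
  have hm0 : m ≠ 0 := hm.pos.ne'
  rw [quadSym_natCast_eq_prod hm0 h]
  conv_lhs => rw [← Nat.prod_primeFactorsList hm0]
  rw [jacobiSym.list_prod_right fun p hp => (Nat.prime_of_mem_primeFactorsList hp).ne_zero]
  congr 1
  refine List.map_congr_left fun p hp => ?_
  have : Fact p.Prime := ⟨Nat.prime_of_mem_primeFactorsList hp⟩
  rw [← jacobiSym.legendreSym.to_jacobiSym]
  refine legendreSym_intDisc_eq_quadSym G p ?_ (not_dvd_of_mem_primeFactorsList h hp)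
  rintro rfl
  exact (Nat.not_even_iff_odd.2 hm) (even_iff_two_dvd.2 (Nat.dvd_of_mem_primeFactorsList hp))

theorem odd_intDisc (h : ¬ 2 ∣ Nat.card G) : Odd (intDisc G) := by
  have : Fintype {C : ConjClasses G // IsRealClass C} := Fintype.ofFinite _
  rw [intDisc, finprod_eq_prod_of_fintype]
  refine Odd.mul odd_neg_one.pow
    (Finset.prod_induction _ Odd (fun _ _ => Odd.mul) odd_one fun C _ => ?_)
  rw [Int.odd_coe_nat, ← Nat.not_even_iff_odd, even_iff_two_dvd]
  exact fun h2 => h (h2.trans (centralizerCard_dvd_card G C.1))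

theorem gcd_card_of_isCoprime_intDisc {a : ℤ} (h : IsCoprime a (intDisc G)) :
    Int.gcd a (Nat.card G) = 1 :=
  Int.isCoprime_iff_gcd_eq_one.1 (h.of_isCoprime_of_dvd_right (card_dvd_intDisc G))

/-- With `N = |d|`, the modulus `m = 2N - 1` is `1` modulo `4` and `-1` modulo `N`. Hence `(-1/G) =
(d/m) = (N/m) = (m/N) = (-1/N) = χ₄(N)`. As `(-1/G)` is also the sign of `d`, that sign is
`χ₄(|d|)`, which means `d ≡ 1 mod 4`. -/
theorem intDisc_emod_four (h : ¬ 2 ∣ Nat.card G) : intDisc G % 4 = 1 := by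
  have hodd := odd_intDisc G h
  obtain ⟨N, hN⟩ : ∃ N : ℕ, N = (intDisc G).natAbs := ⟨_, rfl⟩
  have hNo : Odd N := by rw [hN]; exact hodd.natAbs
  have hN0 : 0 < N := hNo.pos
  obtain ⟨m, hm⟩ : ∃ m : ℕ, m + 1 = 2 * N := ⟨2 * N - 1, by omega⟩
  have hm4 : m % 4 = 1 := by
    have := Nat.odd_iff.1 hNo
    omega
  have hmo : Odd m := Nat.odd_iff.2 (by omega)
  have hmodd : (m : ℤ) ≡ -1 [ZMOD N] := by
    refine (Int.modEq_iff_dvd.2 ⟨-2, ?_⟩)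
    linarith [(by exact_mod_cast hm : (m : ℤ) + 1 = 2 * N)]
  have hdvd : (Nat.card G : ℤ) ∣ N := by
    rw [hN, Int.dvd_natAbs]
    exact card_dvd_intDisc G
  have hmG := hmodd.of_dvd hdvd
  have hgcd : Int.gcd m (Nat.card G) = 1 := by
    rw [← Int.gcd_emod, hmG, Int.gcd_emod, gcd_neg_one_left_eq]
  have hJ := jacobiSym_intDisc G hmo hgcd
  rw [quadSym_congr hmG] at hJ
  have hJN : J(N | m) = ZMod.χ₄ N := by
    rw [jacobiSym.quadratic_reciprocity_one_mod_four' hNo hm4, ← jacobiSym.at_neg_one hNo]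
    exact jacobiSym.mod_left' hmodd
  have hJm : J(intDisc G | m) = J(N | m) := by
    rcases Int.natAbs_eq (intDisc G) with hd | hd
    · rw [hd, ← hN]
    · rw [hd, ← hN, jacobiSym.neg _ hmo, ZMod.χ₄_nat_one_mod_four hm4, one_mul]
  rw [hJm, hJN] at hJ
  have hsign := sign_intDisc G
  rw [← hJ] at hsign
  have hN4 : N % 4 = 1 ∨ N % 4 = 3 := by
    have := Nat.odd_iff.1 hNo
    omega
  rcases hN4 with h4 | h4
  · rw [ZMod.χ₄_nat_one_mod_four h4] at hsign
    have : ¬ intDisc G < 0 := by rw [hsign]; decide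
    omega
  · rw [ZMod.χ₄_nat_three_mod_four h4] at hsign
    have : intDisc G < 0 := hsign.2 rfl
    omega

/-- The argument `2` is replaced by the odd modulus `2 + N` with `N = |d|`, and reciprocity gives
`(d/(2+N)) = ((2+N)/N) = (2/N)`. -/
theorem quadSym_two (h : ¬ 2 ∣ Nat.card G) : quadSym G 2 = kroneckerPrime (intDisc G) 2 := by
  have hd4 := intDisc_emod_four G h
  obtain ⟨N, hN⟩ : ∃ N : ℕ, N = (intDisc G).natAbs := ⟨_, rfl⟩
  have hNo : Odd N := Nat.odd_iff.2 (by omega)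
  have hmo : Odd (2 + N) := Nat.odd_iff.2 (by have := Nat.odd_iff.1 hNo; omega)
  have hdvd : (Nat.card G : ℤ) ∣ N := by
    rw [hN, Int.dvd_natAbs]
    exact card_dvd_intDisc G
  have hmodd : ((2 + N : ℕ) : ℤ) ≡ 2 [ZMOD N] := by
    simp
  have hmG := hmodd.of_dvd hdvd
  have hgcd : Int.gcd (2 + N : ℕ) (Nat.card G) = 1 := by
    rw [← Int.gcd_emod, hmG, Int.gcd_emod]
    exact (Nat.Prime.coprime_iff_not_dvd Nat.prime_two).2 h
  have hJ := jacobiSym_intDisc G hmo hgcd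
  rw [quadSym_congr hmG] at hJ
  have hN2 : J((2 + N : ℕ) | N) = ZMod.χ₈ N := by
    rw [← jacobiSym.at_two hNo]
    exact jacobiSym.mod_left' hmodd
  have hJm : J(intDisc G | 2 + N) = ZMod.χ₈ N := by
    rw [← hN2]
    -- As `d ≡ 1 mod 4`, either `N = d ≡ 1 mod 4`, or `N = -d ≡ 3 mod 4` and `2 + N ≡ 1 mod 4`.
    -- Reciprocity has no sign in either case.
    rcases Int.natAbs_eq (intDisc G) with hd | hd
    · rw [hd, ← hN, jacobiSym.quadratic_reciprocity_one_mod_four (by omega) hmo]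
    · have h4 : (2 + N) % 4 = 1 := by omega
      rw [hd, ← hN, jacobiSym.neg _ hmo, ZMod.χ₄_nat_one_mod_four h4, one_mul,
        jacobiSym.quadratic_reciprocity_one_mod_four' hNo h4]
  rw [← hJ, hJm, ZMod.χ₈_nat_eq_if_mod_eight, kroneckerPrime, if_pos rfl]
  have hN2' : N % 2 ≠ 0 := by omega
  have hd2 : intDisc G % 2 ≠ 0 := by omega
  rw [if_neg hN2', if_neg hd2]
  -- The residues `±1` modulo `8` do not distinguish `d` from `|d|`.
  refine if_congr ?_ rfl rfl
  omega

theorem quadSym_prime {p : ℕ} (hp : p.Prime) (h : ¬ p ∣ Nat.card G) :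
    quadSym G p = kroneckerPrime (intDisc G) p := by
  rcases eq_or_ne p 2 with rfl | hp2
  · exact quadSym_two G h
  · have : Fact p.Prime := ⟨hp⟩
    rw [kroneckerPrime, if_neg hp2, ← jacobiSym.legendreSym.to_jacobiSym,
      legendreSym_intDisc_eq_quadSym G p hp2 h]

theorem kroneckerPrime_intDisc_eq_zero {p : ℕ} (hp : p.Prime) (h : p ∣ Nat.card G) :
    kroneckerPrime (intDisc G) p = 0 := by
  have hd : (p : ℤ) ∣ intDisc G :=
    (Int.natCast_dvd_natCast.2 h).trans (card_dvd_intDisc G)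
  rw [kroneckerPrime]
  split_ifs with hp2 h2 h8
  · rfl
  · subst hp2; omega
  · subst hp2; omega
  · have : Fact p.Prime := ⟨hp⟩
    rw [← jacobiSym.legendreSym.to_jacobiSym, legendreSym.eq_zero_iff, ZMod.intCast_zmod_eq_zero_iff_dvd]
    exact hd

/-- `0` is prime to `|G|` only for the trivial group; since `|G|` divides `d`, a unit `d` also
forces this. -/
theorem quadSym_zero : quadSym G 0 = kroneckerSym (intDisc G) 0 := by
  rw [kroneckerSym, if_pos rfl]
  by_cases h : Nat.card G = 1
  · have : Subsingleton G := (Nat.card_eq_one_iff_unique.1 h).1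
    have hcong : (0 : ℤ) ≡ 1 [ZMOD Nat.card G] := by
      rw [h]
      exact Int.modEq_one
    have hunit : intDisc G = 1 ∨ intDisc G = -1 := by
      have : Fintype {C : ConjClasses G // IsRealClass C} := Fintype.ofFinite _
      rw [intDisc, finprod_eq_prod_of_fintype, Finset.prod_eq_one, mul_one]
      · exact neg_one_pow_eq_or ℤ _
      · intro C _
        have := centralizerCard_dvd_card G C.1
        rw [h, Nat.dvd_one] at this
        simp [this]
    rw [quadSym_congr hcong, quadSym_one, if_pos hunit]
  · have hunit : ¬ (intDisc G = 1 ∨ intDisc G = -1) := by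
      intro hu
      have hd := card_dvd_intDisc G
      have hone := Int.isUnit_iff_natAbs_eq.1 (isUnit_of_dvd_unit hd (Int.isUnit_iff.2 hu))
      exact h (by simpa using hone)
    rw [if_neg hunit]
    simp [quadSym, h]

theorem quadSym_eq_kroneckerSym (a : ℤ) : quadSym G a = kroneckerSym (intDisc G) a := by
  rcases eq_or_ne a 0 with rfl | ha0
  · exact quadSym_zero G
  rw [kroneckerSym, if_neg ha0]
  have hn0 : a.natAbs ≠ 0 := Int.natAbs_ne_zero.2 ha0
  by_cases ha : Int.gcd a (Nat.card G) = 1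
  · have habs : Int.gcd a.natAbs (Nat.card G) = 1 := by
      rwa [Int.gcd, Int.natAbs_natCast]
    have hprod : (a.natAbs.primeFactorsList.map (kroneckerPrime (intDisc G))).prod =
        quadSym G a.natAbs := by
      rw [quadSym_natCast_eq_prod hn0 habs]
      congr 1
      refine List.map_congr_left fun p hp => ?_
      exact (quadSym_prime G (Nat.prime_of_mem_primeFactorsList hp)
        (not_dvd_of_mem_primeFactorsList ha hp)).symm
    rw [hprod]
    rcases lt_or_ge a 0 with hneg | hpos
    · have hmul : quadSym G a = quadSym G (-1) * quadSym G a.natAbs := by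
        rw [← quadSym_mul (gcd_neg_one_left_eq _) habs]
        congr 1
        omega
      rw [hmul]
      congr 1
      rcases quadSym_eq_one_or_neg_one G (gcd_neg_one_left_eq (Nat.card G)) with h | h <;>
        simp [h, hneg, sign_intDisc]
    · rw [if_neg (fun h => absurd h.1 hpos.not_gt), one_mul, Int.natAbs_of_nonneg hpos]
  · obtain ⟨p, hp, hpa, hpG⟩ := Nat.Prime.not_coprime_iff_dvd.1 ha
    have hzero : (a.natAbs.primeFactorsList.map (kroneckerPrime (intDisc G))).prod = 0 := by
      refine List.prod_eq_zero (List.mem_map.2 ⟨p, ?_, kroneckerPrime_intDisc_eq_zero G hp hpG⟩)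
      exact (Nat.mem_primeFactorsList hn0).2 ⟨hp, hpa⟩
    rw [hzero, mul_zero]
    simp [quadSym, ha]

theorem kroneckerPrime_eq_one_of_isSquare {d : ℤ} (hd : IsSquare d) {p : ℕ}
    (h0 : kroneckerPrime d p ≠ 0) : kroneckerPrime d p = 1 := by
  obtain ⟨s, rfl⟩ := hd
  rw [kroneckerPrime] at h0 ⊢
  split_ifs at h0 ⊢ with hp2 h2 h8
  · exact absurd rfl h0
  · rfl
  · exfalso
    apply h8
    have h1 := Int.emod_nonneg s (show (8 : ℤ) ≠ 0 by norm_num)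
    have h3 := Int.emod_lt_of_pos s (show (0 : ℤ) < 8 by norm_num)
    have h4 : s % 8 % 2 ≠ 0 := by
      intro h
      apply h2
      rw [Int.mul_emod, show s % 2 = 0 by omega]
      rfl
    rw [Int.mul_emod]
    generalize s % 8 = t at h1 h3 h4
    interval_cases t <;> simp_all
  · rw [jacobiSym.mul_left] at h0 ⊢
    rcases jacobiSym.trichotomy s p with h | h | h <;> simp_all

/-- Triviality at `-1` makes `d` positive. If `d` were not a square, some odd `m` would have `(d/m)
= -1`; such an `m` is prime to `d`, hence to `|G|`, a contradiction. Conversely, for a square `d`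
every nonzero prime factor of the Kronecker symbol is `1`. -/
theorem quadSym_trivial_iff :
    (∀ a : ℤ, Int.gcd a (Nat.card G) = 1 → quadSym G a = 1) ↔ IsSquare (intDisc G) := by
  constructor
  · intro h
    have hpos : 0 ≤ intDisc G := by
      rw [← not_lt, sign_intDisc, h _ (gcd_neg_one_left_eq _)]
      decide
    obtain ⟨N, hN⟩ := Int.eq_ofNat_of_zero_le hpos
    by_contra hsq
    have hN0 : N ≠ 0 := by
      rintro rfl
      exact intDisc_ne_zero G hN
    obtain ⟨m, hm, hJ⟩ := exists_jacobiSym_eq_neg_one hN0 (fun hs => hsq (by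
      rw [hN]
      exact hs.map (Nat.castRingHom ℤ)))
    rw [← hN] at hJ
    have hco : Int.gcd (intDisc G) m = 1 := by
      by_contra hne
      have := jacobiSym.eq_zero_iff.2 ⟨hm.pos.ne', hne⟩
      rw [hJ] at this
      exact absurd this (by decide)
    have hgcd := gcd_card_of_isCoprime_intDisc G (Int.isCoprime_iff_gcd_eq_one.2 hco).symm
    rw [jacobiSym_intDisc G hm hgcd, h _ hgcd] at hJ
    exact absurd hJ (by decide)
  · intro hsq a ha
    have hpos : ¬ intDisc G < 0 := not_lt.2 hsq.nonneg
    rcases eq_or_ne a 0 with rfl | ha0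
    · have h1 : Nat.card G = 1 := by simpa using ha
      rw [quadSym_congr (b := 1) (by rw [h1]; exact Int.modEq_one), quadSym_one]
    have hne : quadSym G a ≠ 0 := by
      rcases quadSym_eq_one_or_neg_one G ha with h | h <;> simp [h]
    rw [quadSym_eq_kroneckerSym, kroneckerSym, if_neg ha0, if_neg fun h => hpos h.2, one_mul]
      at hne ⊢
    refine List.prod_eq_one fun x hx => ?_
    obtain ⟨p, -, rfl⟩ := List.mem_map.1 hx
    refine kroneckerPrime_eq_one_of_isSquare hsq ?_
    intro h0
    exact hne (List.prod_eq_zero (h0 ▸ hx))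

end Reciprocity

end GroupReciprocity

theorem theorem1 (G : Type*) [Group G] [Finite G] :
    ∃ d : ℤ, (d : ℚ) = GroupReciprocity.groupDisc G ∧ d ≠ 0 ∧
      (d ≡ 0 [ZMOD 4] ∨ d ≡ 1 [ZMOD 4]) ∧
      (∀ a : ℤ, GroupReciprocity.quadSym G a = GroupReciprocity.kroneckerSym d a) ∧
      ((∀ a : ℤ, Int.gcd a (Nat.card G) = 1 → GroupReciprocity.quadSym G a = 1) ↔
        IsSquare d) := by
  refine ⟨GroupReciprocity.intDisc G, GroupReciprocity.intDisc_cast G,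
    GroupReciprocity.intDisc_ne_zero G, ?_, GroupReciprocity.quadSym_eq_kroneckerSym G,
    GroupReciprocity.quadSym_trivial_iff G⟩
  by_cases h : 2 ∣ Nat.card G
  · exact Or.inl ((GroupReciprocity.four_dvd_intDisc G h).modEq_zero_int)
  · exact Or.inr (GroupReciprocity.intDisc_emod_four G h)
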